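/- For $n\ge 0$ fix a Borel subalgebra (i.e. a maximal solvable Lie subalgebra) $\mathfrak b_n$ of $\mathfrak{sl}(n+1,\mathbb C)$, and let $\mathcal I^n$ be the set of $ad$-nilpotent ideals of $\mathfrak b_n$, i.e. of those ideals of $\mathfrak b_n$ all of whose elements are $ad$-nilpotent in $\mathfrak{sl}(n+1,\mathbb C)$. The class of nilpotence of $\mathfrak i\in\mathcal I^n$ is the least $m\ge 0$ with $C^m(\mathfrak i)=0$, where $C^0(\mathfrak i)=\mathfrak i$ and $C^{m+1}(\mathfrak i)=[\mathfrak i,C^m(\mathfrak i)]$ (so the zero ideal has class $0$ and the abelian ideals are those of class at most $1$). For $h\ge 0$ let $\alpha_n(h)$ be the number of ideals in $\mathcal I^n$ with class of nilpotence at most $h$; this number is finite. Let $U_k$ denote the $k$-th Chebyshev polynomial of the second kind, $U_k(\cos t)=\sin((k+1)t)/\sin t$. Then for every $h\ge 0$, as an identity of formal Laurent series in $\sqrt x$ with rational coefficients, $$ 1+\sum_{n=0}^\infty\alpha_n(h)\,x^{n+1} =\frac{U_{h+1}\!\left(\frac{1}{2\sqrt x}\right)}{\sqrt x\;U_{h+2}\!\left(\frac{1}{2\sqrt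 x}\right)} =\cfrac{1}{1-\cfrac{x}{1-\cfrac{x}{\ddots\,\cfrac{\ddots}{1-x}}}}\,, $$ where the continued fraction contains exactly $h+1$ occurrences of $x$; that is, it equals $c_{h+1}$, where $c_0=1$ and $c_{k+1}=1/(1-x\,c_k)$. -/

import Mathlib

open LieAlgebra.SpecialLinear

/-- A Borel subalgebra of a Lie algebra: a maximal solvable Lie subalgebra. -/
def IsBorelSubalgebra {L : Type*} [LieRing L] [LieAlgebra ℂ L] (b : LieSubalgebra ℂ L) : Prop :=
  Maximal (fun s : LieSubalgebra ℂ L => LieAlgebra.IsSolvable s) b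

/-- An ideal `I` of a subalgebra `b` of `L` is `ad`-nilpotent if each of its elements is an
`ad`-nilpotent element of `L`. -/
def IsAdNilpotentIdeal {L : Type*} [LieRing L] [LieAlgebra ℂ L] (b : LieSubalgebra ℂ L)
    (I : LieIdeal ℂ b) : Prop :=
  ∀ y : b, y ∈ I → IsNilpotent (LieAlgebra.ad ℂ L (y : L))

/-- The class of nilpotence of an ideal `I`, viewed as a Lie algebra: the least `m` such that
the `m`-fold bracketing of `I` with itself vanishes, i.e. such that the `m`-th term of the lower
central series `C⁰ = I`, `Cᵐ⁺¹ = ⁅I, Cᵐ⁆` is zero. So the zero ideal has class `0`, and the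
abelian ideals are those of class at most `1`. -/
noncomputable def idealNilpotencyClass {L : Type*} [LieRing L] [LieAlgebra ℂ L]
    {b : LieSubalgebra ℂ L} (I : LieIdeal ℂ b) : ℕ :=
  sInf {m : ℕ | LieModule.lowerCentralSeries ℂ I I m = ⊥}

/-- The `ad`-nilpotent ideals of `b` that are nilpotent Lie algebras of class at most `h`. -/
def adNilpotentIdealsOfClassLE {L : Type*} [LieRing L] [LieAlgebra ℂ L]
    (b : LieSubalgebra ℂ L) (h : ℕ) : Set (LieIdeal ℂ b) :=
  {I | IsAdNilpotentIdeal b I ∧ LieRing.IsNilpotent I ∧ idealNilpotencyClass I ≤ h}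

/-- The formal power series `1 + ∑ₙ αₙ(h) xⁿ⁺¹`, where `αₙ(h)` is the number of `ad`-nilpotent
ideals of class at most `h` in the Borel subalgebra `b n` of `sl(n + 1, ℂ)`. -/
noncomputable def idealGenFun (b : ∀ n : ℕ, LieSubalgebra ℂ (sl (Fin (n + 1)) ℂ)) (h : ℕ) :
    PowerSeries ℚ :=
  1 + PowerSeries.X * PowerSeries.mk fun n => ((adNilpotentIdealsOfClassLE (b n) h).ncard : ℚ)

/-- The finite continued fraction `1/(1 - x/(1 - x/(⋯/(1 - x))))` with `k` occurrences of `x`. -/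
def contFrac {K : Type*} [Field K] (x : K) : ℕ → K
  | 0 => 1
  | k + 1 => 1 / (1 - x * contFrac x k)

/-- The formal square root `√x` of the indeterminate `x`: identities between formal series in `x`
that involve `√x` are read in the field of formal Laurent series in `√x`. -/
noncomputable def sqrtX : LaurentSeries ℚ := ((PowerSeries.X : PowerSeries ℚ) : LaurentSeries ℚ)

/-- A formal power series `F(x)`, read as a Laurent series in `√x`, i.e. `F(√x ^ 2)`. -/
noncomputable def inSqrtX (F : PowerSeries ℚ) : LaurentSeries ℚ :=
  ((PowerSeries.expand 2 two_ne_zero F : PowerSeries ℚ) : LaurentSeries ℚ)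

/-- The value `U_k(y)` of the `k`-th Chebyshev polynomial of the second kind. -/
noncomputable def chebyshevU {K : Type*} [Field K] (k : ℕ) (y : K) : K :=
  (Polynomial.Chebyshev.U K (k : ℤ)).eval y

/-! Put N = n + 1. By Lie's theorem and maximality, a Borel subalgebra of sl(N) is conjugate to the
traceless upper triangular matrices (`IsBorelSubalgebra.exists_model`). Its ad-nilpotent ideals then
become the ideals of strictly upper triangular matrices (`isAdNilpotentIdeal_iff`). Such an ideal is
stable under the torus, hence spanned by matrix units. It is recorded by the monotone function f
sending a row to its first admissible column, with f(i) > i for i < N and f = N from N on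
(`exists_eq_staircaseIdeal`). Brackets compose these functions, so the class is at most h exactly
when f^[h + 1](0) = N (`lowerCentralSeries_eq_bot_iff`).

These f are counted by fixing their values from left to right while following the orbit 0, f(0),
f(f(0)), ... The count of completions is a coefficient of a product of powers of two consecutive
continued fractions c_{k+1}, c_k (`encard_restrictedStaircases`), and its recursion is c_{k+1} = 1 +
x c_{k+1} c_k. Starting at 0 gives the coefficient of x^N in c_{h+1}. The Chebyshev quotient
satisfies the same recursion as c_k (`contFrac_sqrtX_eq`). -/

/-! ### Lie's theorem in matrix form. -/

/-- A solvable Lie algebra acts by upper triangular matrices in a suitable basis. -/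
theorem exists_basis_upperTriangular {L : Type*} [LieRing L] [LieAlgebra ℂ L]
    [LieAlgebra.IsSolvable L] {n : ℕ} {V : Type*} [AddCommGroup V] [Module ℂ V]
    [LieRingModule L V] [LieModule ℂ L V] [Module.Finite ℂ V] (hV : Module.finrank ℂ V = n) :
    ∃ v : Module.Basis (Fin n) ℂ V, ∀ (x : L) (i j : Fin n), j < i → v.repr ⁅x, v j⁆ i = 0 := by
  induction n generalizing V with
  | zero => exact ⟨Module.finBasisOfFinrankEq ℂ V hV, fun _ i => i.elim0⟩
  | succ n ih =>
    have : Nontrivial V := Module.nontrivial_of_finrank_pos (R := ℂ) (by omega)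
    obtain ⟨χ, hχ⟩ := LieModule.exists_nontrivial_weightSpace_of_isSolvable ℂ L V
    obtain ⟨⟨v₀, hv₀⟩, hne⟩ := exists_ne (0 : LieModule.weightSpace V χ)
    rw [LieModule.mem_weightSpace] at hv₀
    replace hne : v₀ ≠ 0 := by simpa using hne
    -- The line of a common eigenvector is a submodule; a triangular basis of the quotient is lifted
    -- and placed after it.
    let N : LieSubmodule ℂ L V :=
      { Submodule.span ℂ {v₀} with
        lie_mem := by
          intro x m hm
          obtain ⟨c, rfl⟩ := Submodule.mem_span_singleton.1 hm
          refine Submodule.mem_span_singleton.2 ⟨c * χ x, ?_⟩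
          rw [lie_smul, hv₀, smul_smul] }
    have hN : Module.finrank ℂ N.toSubmodule = 1 := finrank_span_singleton hne
    have hQ : Module.finrank ℂ (V ⧸ N) = n := by
      have := N.toSubmodule.finrank_quotient_add_finrank
      change Module.finrank ℂ (V ⧸ N.toSubmodule) = n
      omega
    obtain ⟨w, hw⟩ := ih hQ
    let u := Module.finBasisOfFinrankEq ℂ N.toSubmodule hN
    let s := Module.Basis.sumQuot u w
    let e : Fin 1 ⊕ Fin n ≃ Fin (n + 1) := finSumFinEquiv.trans (finCongr (add_comm 1 n))
    have e₁ (j : Fin n) : e.symm j.succ = Sum.inr j := by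
      rw [Equiv.symm_apply_eq]; ext; simp [e]
    have e₀ : e.symm 0 = Sum.inl 0 := by
      rw [Equiv.symm_apply_eq]; ext; simp [e]
    have key (y : V) (i : Fin n) : s.repr y (Sum.inr i) = w.repr (Submodule.Quotient.mk y) i :=
      Module.Basis.sumQuot_repr_inr u w y i
    refine ⟨s.reindex e, fun x i j hij => ?_⟩
    obtain ⟨i, rfl⟩ := Fin.exists_succ_eq.2 (Fin.ne_zero_of_lt hij)
    rw [Module.Basis.repr_reindex_apply, Module.Basis.reindex_apply, e₁, key]
    induction j using Fin.cases with
    | zero =>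
      have h : ⁅x, s (e.symm 0)⁆ ∈ N := by
        rw [e₀, Module.Basis.sumQuot_inl]
        exact N.lie_mem (u 0).2
      rw [(Submodule.Quotient.mk_eq_zero _).2 h]; simp
    | succ j =>
      have h := hw x i j (by simpa using hij)
      rw [e₁]
      rw [← Module.Basis.sumQuot_inr u w j] at h
      exact h

-- Ideals of the Lie algebra of traceless upper triangular matrices.

attribute [local instance 100] LieRing.ofAssociativeRing

section UpperTriangularModel

variable {B : Type*} [LieRing B] [LieAlgebra ℂ B] {N : ℕ}

/-- A linear representation of `B` which identifies it with the Lie algebra of traceless upper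
triangular matrices. -/
structure IsUpperTriangularModel (φ : B →ₗ⁅ℂ⁆ Matrix (Fin N) (Fin N) ℂ) : Prop where
  injective : Function.Injective φ
  upper : ∀ x i j, j < i → φ x i j = 0
  exists_eq : ∀ A : Matrix (Fin N) (Fin N) ℂ, (∀ i j, j < i → A i j = 0) → A.trace = 0 →
    ∃ x, φ x = A

theorem apply_lie_apply (φ : B →ₗ⁅ℂ⁆ Matrix (Fin N) (Fin N) ℂ) (x y : B) (i j : Fin N) :
    φ ⁅x, y⁆ i j = ∑ k, (φ x i k * φ y k j - φ y i k * φ x k j) := by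
  rw [LieHom.map_lie, Ring.lie_def, Matrix.sub_apply, Matrix.mul_apply, Matrix.mul_apply,
    Finset.sum_sub_distrib]

/-- The ideal of the elements whose `i`-th row vanishes in the columns before `g i`. -/
def staircaseIdeal (φ : B →ₗ⁅ℂ⁆ Matrix (Fin N) (Fin N) ℂ) (hφ : ∀ x i j, j < i → φ x i j = 0)
    (g : ℕ → ℕ) (hg : Monotone g) : LieIdeal ℂ B where
  carrier := {y | ∀ i j : Fin N, (j : ℕ) < g i → φ y i j = 0}
  add_mem' := by
    intro a b ha hb i j hij
    simp [ha i j hij, hb i j hij]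
  zero_mem' := by simp
  smul_mem' := by
    intro c x hx i j hij
    simp [hx i j hij]
  lie_mem := by
    intro x y hy i j hij
    rw [apply_lie_apply]
    refine Finset.sum_eq_zero fun k _ => ?_
    have h₁ : φ x i k * φ y k j = 0 := by
      rcases lt_or_ge k i with hk | hk
      · rw [hφ x i k hk, zero_mul]
      · rw [hy k j (hij.trans_le (hg hk)), mul_zero]
    have h₂ : φ y i k * φ x k j = 0 := by
      rcases lt_or_ge j k with hk | hk
      · rw [hφ x k j hk, mul_zero]
      · rw [hy i k (lt_of_le_of_lt hk hij), zero_mul]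
    rw [h₁, h₂, sub_zero]

theorem mem_staircaseIdeal {φ : B →ₗ⁅ℂ⁆ Matrix (Fin N) (Fin N) ℂ}
    {hφ : ∀ x i j, j < i → φ x i j = 0} {g : ℕ → ℕ} {hg : Monotone g} {y : B} :
    y ∈ staircaseIdeal φ hφ g hg ↔ ∀ i j : Fin N, (j : ℕ) < g i → φ y i j = 0 :=
  Iff.rfl

theorem mem_staircaseIdeal_of_eq_single {φ : B →ₗ⁅ℂ⁆ Matrix (Fin N) (Fin N) ℂ}
    {hφ : ∀ x i j, j < i → φ x i j = 0} {g : ℕ → ℕ} {hg : Monotone g} {y : B} {i j : Fin N}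
    (hy : φ y = Matrix.single i j 1) : y ∈ staircaseIdeal φ hφ g hg ↔ g i ≤ j := by
  rw [mem_staircaseIdeal]
  constructor
  · intro h
    by_contra! hlt
    simpa [hy] using h i j hlt
  · intro h a b hab
    rw [hy]
    apply Matrix.single_apply_of_ne
    rintro ⟨rfl, rfl⟩
    omega

/-- A Lie algebra with an injective representation by upper triangular matrices is solvable. -/
theorem isSolvable_of_upperTriangular (φ : B →ₗ⁅ℂ⁆ Matrix (Fin N) (Fin N) ℂ)
    (hinj : Function.Injective φ) (hφ : ∀ x i j, j < i → φ x i j = 0) :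
    LieAlgebra.IsSolvable B := by
  have hmono (k : ℕ) : Monotone fun i : ℕ => i + k := fun a b h => Nat.add_le_add_right h k
  have key (k : ℕ) : LieAlgebra.derivedSeries ℂ B k ≤ staircaseIdeal φ hφ _ (hmono k) := by
    induction k with
    | zero => intro y _ i j hij; exact hφ y i j hij
    | succ k ih =>
      rw [LieAlgebra.derivedSeries_def, LieAlgebra.derivedSeriesOfIdeal_succ, LieSubmodule.lie_le_iff]
      intro x hx y hy i j hij
      replace hx := ih hx
      replace hy := ih hy
      rw [mem_staircaseIdeal] at hx hy
      rw [apply_lie_apply]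
      refine Finset.sum_eq_zero fun l _ => ?_
      dsimp only at hx hy hij
      -- Only for k = 0 can a term have both factors nonzero: the product of diagonal entries, which
      -- cancels in the commutator.
      by_cases h : k = 0 ∧ l = i ∧ l = j
      · obtain ⟨-, rfl, rfl⟩ := h
        ring
      · by_cases h₁ : (l : ℕ) < i + k
        · rw [hx i l h₁, hy i l h₁]; ring
        · have h₂ : (j : ℕ) < l + k := by
            by_contra h₂
            exact h ⟨by omega, Fin.ext (by omega), Fin.ext (by omega)⟩
          rw [hx l j h₂, hy l j h₂]; ring
  refine LieAlgebra.IsSolvable.mk (R := ℂ) (k := N) ?_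
  rw [eq_bot_iff]
  intro y hy
  rw [LieSubmodule.mem_bot]
  apply hinj
  rw [map_zero]
  ext i j
  exact key N hy i j (by dsimp only; omega)

namespace IsUpperTriangularModel

variable {φ : B →ₗ⁅ℂ⁆ Matrix (Fin N) (Fin N) ℂ} (hφ : IsUpperTriangularModel φ)
include hφ

theorem exists_eq_single {i j : Fin N} (hij : i < j) : ∃ x, φ x = Matrix.single i j 1 := by
  refine hφ.exists_eq _ (fun a b hab => ?_) (Matrix.trace_single_eq_of_ne _ _ _ hij.ne)
  apply Matrix.single_apply_of_ne
  rintro ⟨rfl, rfl⟩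
  exact absurd hij hab.asymm

/-- The elements of the torus separating the row and column indices. -/
theorem exists_torus (k : Fin N) : ∃ d : B, ∀ (y : B) (i j : Fin N),
    φ ⁅d, y⁆ i j = ((if i = k then 1 else 0) - (if j = k then 1 else 0)) * φ y i j := by
  have hN : (N : ℂ) ≠ 0 := by have := k.pos; exact_mod_cast this.ne'
  -- The scalar 1/N makes the k-th diagonal unit traceless and drops out of commutators.
  let D : Matrix (Fin N) (Fin N) ℂ :=
    Matrix.diagonal fun i => (if i = k then 1 else 0) - 1 / (N : ℂ)
  obtain ⟨d, hd⟩ := hφ.exists_eq D (fun i j hij => Matrix.diagonal_apply_ne _ hij.ne')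
    (by simp [D, Matrix.trace_diagonal, hN])
  refine ⟨d, fun y i j => ?_⟩
  rw [LieHom.map_lie, hd, Ring.lie_def, Matrix.sub_apply, Matrix.diagonal_mul,
    Matrix.mul_diagonal]
  ring

/-- Torus brackets isolate one nonzero entry of y; brackets with matrix units then move it up and to
the right. -/
theorem exists_mem_eq_single (I : LieIdeal ℂ B)
    (hI : ∀ y ∈ I, ∀ i j, j ≤ i → φ y i j = 0) {y : B} (hy : y ∈ I) {i j i' j' : Fin N}
    (hij : φ y i j ≠ 0) (hi : i' ≤ i) (hj : j ≤ j') : ∃ z ∈ I, φ z = Matrix.single i' j' 1 := by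
  have hlt : i < j := by
    by_contra! h
    exact hij (hI y hy i j h)
  have h₁ : ∃ z ∈ I, φ z = Matrix.single i j 1 := by
    obtain ⟨d, hd⟩ := hφ.exists_torus i
    obtain ⟨e, he⟩ := hφ.exists_torus j
    -- ad d has eigenvalues t in {1, 0, -1} on entries, and t(t + 1)/2 is the indicator of t = 1:
    -- only row i survives. For w, t(t - 1)/2 is the indicator of t = -1, which selects column j.
    let z := (1 / 2 : ℂ) • (⁅d, ⁅d, y⁆⁆ + ⁅d, y⁆)
    have hz : z ∈ I :=
      I.smul_mem _ (add_mem (lie_mem_right _ _ _ _ _ (lie_mem_right _ _ _ _ _ hy))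
        (lie_mem_right _ _ _ _ _ hy))
    let w := (1 / 2 : ℂ) • (⁅e, ⁅e, z⁆⁆ - ⁅e, z⁆)
    have hw : w ∈ I :=
      I.smul_mem _ (sub_mem (lie_mem_right _ _ _ _ _ (lie_mem_right _ _ _ _ _ hz))
        (lie_mem_right _ _ _ _ _ hz))
    refine ⟨(φ y i j)⁻¹ • w, I.smul_mem _ hw, ?_⟩
    ext a b
    have hza (a b) : φ z a b = if a = i then φ y a b else 0 := by
      simp only [z, map_smul, map_add, Matrix.smul_apply, Matrix.add_apply, hd, smul_eq_mul]
      split_ifs with h₁ h₂ h₂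
      · subst h₁ h₂
        rw [hI y hy b b le_rfl]; ring
      all_goals ring
    have hwa : φ w a b = if b = j then φ z a b else 0 := by
      simp only [w, map_smul, map_sub, Matrix.smul_apply, Matrix.sub_apply, he, smul_eq_mul]
      split_ifs with h₁ h₂ h₂
      · rw [h₁, h₂, hI z hz j j le_rfl]; ring
      all_goals ring
    rw [map_smul, Matrix.smul_apply, hwa, hza, Matrix.single_apply]
    by_cases ha : a = i
    · by_cases hb : b = j
      · subst ha hb; simp [hij]
      · simp [hb, Ne.symm hb]
    · simp [ha, Ne.symm ha]
  have h₂ : ∃ z ∈ I, φ z = Matrix.single i' j 1 := by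
    obtain ⟨z, hz, hzφ⟩ := h₁
    rcases hi.eq_or_lt with rfl | hi
    · exact ⟨z, hz, hzφ⟩
    · obtain ⟨x, hx⟩ := hφ.exists_eq_single hi
      refine ⟨⁅x, z⁆, lie_mem_right _ _ _ _ _ hz, ?_⟩
      rw [LieHom.map_lie, hx, hzφ, Ring.lie_def, Matrix.single_mul_single_same,
        Matrix.single_mul_single_of_ne _ _ _ _ (hi.trans hlt).ne', sub_zero, one_mul]
  obtain ⟨z, hz, hzφ⟩ := h₂
  rcases hj.eq_or_lt with rfl | hj
  · exact ⟨z, hz, hzφ⟩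
  · obtain ⟨x, hx⟩ := hφ.exists_eq_single hj
    refine ⟨⁅z, x⁆, lie_mem_left _ _ _ _ _ hz, ?_⟩
    rw [LieHom.map_lie, hx, hzφ, Ring.lie_def, Matrix.single_mul_single_same,
      Matrix.single_mul_single_of_ne _ _ _ _ ((hi.trans_lt hlt).trans hj).ne', sub_zero, one_mul]

end IsUpperTriangularModel

/-- The functions recording the left ends of the rows of the ideals of strictly upper triangular
matrices of size `N`. -/
structure IsStaircase (N : ℕ) (f : ℕ → ℕ) : Prop where
  mono : Monotone f
  lt_apply : ∀ i < N, i < f i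
  apply_le : ∀ i, f i ≤ N
  apply_eq : ∀ i, N ≤ i → f i = N

namespace IsUpperTriangularModel

variable {φ : B →ₗ⁅ℂ⁆ Matrix (Fin N) (Fin N) ℂ} (hφ : IsUpperTriangularModel φ)
include hφ

theorem exists_eq_staircaseIdeal (I : LieIdeal ℂ B)
    (hI : ∀ y ∈ I, ∀ i j, j ≤ i → φ y i j = 0) :
    ∃ (f : ℕ → ℕ) (hf : IsStaircase N f), staircaseIdeal φ hφ.upper f hf.mono = I := by
  -- Including N keeps the infimum meaningful: it gives N for zero rows and for i outside the
  -- matrix.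
  let S (i : ℕ) : Set ℕ :=
    {j | j = N ∨ ∃ (hi : i < N) (hj : j < N), ∃ y ∈ I, φ y ⟨i, hi⟩ ⟨j, hj⟩ ≠ 0}
  let f (i : ℕ) : ℕ := sInf (S i)
  have hS (i : ℕ) : f i ∈ S i := Nat.sInf_mem ⟨N, Or.inl rfl⟩
  have hle (i : ℕ) : f i ≤ N := Nat.sInf_le (Or.inl rfl)
  have hsingle (i j : Fin N) (h : f i ≤ j) : ∃ z ∈ I, φ z = Matrix.single i j 1 := by
    rcases hS i with h' | ⟨hi, hj, y, hy, hne⟩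
    · omega
    · exact hφ.exists_mem_eq_single I hI hy hne le_rfl h
  have hf : IsStaircase N f := by
    refine ⟨fun i i' hii => ?_, fun i hi => ?_, hle, fun i hi => ?_⟩
    · rcases hS i' with h' | ⟨hi, hj, y, hy, hne⟩
      · rw [h']; exact hle i
      · obtain ⟨z, hz, hzφ⟩ := hφ.exists_mem_eq_single I hI hy hne
          (i' := ⟨i, hii.trans_lt hi⟩) hii le_rfl
        exact Nat.sInf_le (Or.inr ⟨hii.trans_lt hi, hj, z, hz, by simp [hzφ]⟩)
    · rcases hS i with h' | ⟨hi, hj, y, hy, hne⟩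
      · rwa [h']
      · by_contra! h
        exact hne (hI y hy _ _ h)
    · rcases hS i with h' | ⟨hi', _⟩
      · exact h'
      · omega
  refine ⟨f, hf, le_antisymm (fun y hy => ?_) (fun y hy i j hij => ?_)⟩
  · rw [mem_staircaseIdeal] at hy
    have hz (i j : Fin N) : ∃ z ∈ I, φ z = φ y i j • Matrix.single i j 1 := by
      rcases lt_or_ge (j : ℕ) (f i) with h | h
      · exact ⟨0, I.zero_mem, by simp [hy i j h]⟩
      · obtain ⟨z, hz, hzφ⟩ := hsingle i j h
        exact ⟨φ y i j • z, I.smul_mem _ hz, by rw [map_smul, hzφ]⟩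
    choose z hz hzφ using hz
    have : y = ∑ i, ∑ j, z i j := by
      apply hφ.injective
      conv_lhs => rw [Matrix.matrix_eq_sum_single (φ y)]
      simp [hzφ]
    rw [this]
    exact sum_mem fun i _ => sum_mem fun j _ => hz i j
  · by_contra hne
    exact absurd hij (not_lt.2 (Nat.sInf_le (Or.inr ⟨i.2, j.2, y, hy, hne⟩)))

theorem staircaseIdeal_injective {f g : ℕ → ℕ} (hf : IsStaircase N f) (hg : IsStaircase N g)
    (h : staircaseIdeal φ hφ.upper f hf.mono = staircaseIdeal φ hφ.upper g hg.mono) : f = g := by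
  have aux {f g : ℕ → ℕ} (hf : IsStaircase N f) (hg : IsStaircase N g)
      (h : staircaseIdeal φ hφ.upper f hf.mono = staircaseIdeal φ hφ.upper g hg.mono) (i : ℕ) :
      g i ≤ f i := by
    rcases le_or_gt N i with hi | hi
    · rw [hf.apply_eq i hi, hg.apply_eq i hi]
    · rcases (hf.apply_le i).eq_or_lt with hj | hj
      · rw [hj]; exact hg.apply_le i
      · obtain ⟨x, hx⟩ := hφ.exists_eq_single (i := ⟨i, hi⟩) (j := ⟨f i, hj⟩) (hf.lt_apply i hi)
        have : x ∈ staircaseIdeal φ hφ.upper f hf.mono :=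
          (mem_staircaseIdeal_of_eq_single hx).2 le_rfl
        rw [h] at this
        exact (mem_staircaseIdeal_of_eq_single hx).1 this
  exact funext fun i => le_antisymm (aux hg hf h.symm i) (aux hf hg h i)

/-- The m-th term lies in the staircase of f^[m + 1], the shift arising because the 0-th term is the
ideal itself. In row 0 this bound is attained, and by monotonicity row 0 is the last to vanish. -/
theorem lowerCentralSeries_eq_bot_iff {f : ℕ → ℕ} (hf : IsStaircase N f) (hN : 0 < N) (m : ℕ) :
    LieModule.lowerCentralSeries ℂ (staircaseIdeal φ hφ.upper f hf.mono)
      (staircaseIdeal φ hφ.upper f hf.mono) m = ⊥ ↔ f^[m + 1] 0 = N := by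
  set I := staircaseIdeal φ hφ.upper f hf.mono with hI
  have hmono (m : ℕ) : Monotone f^[m] := hf.mono.iterate m
  have hle (m i : ℕ) : f^[m + 1] i ≤ N := by
    rw [Function.iterate_succ_apply']; exact hf.apply_le _
  constructor
  · intro h
    by_contra hne
    have key (m : ℕ) (j : Fin N) (hj : f^[m + 1] 0 ≤ j) :
        ∃ z ∈ LieModule.lowerCentralSeries ℂ I I m, φ z = Matrix.single ⟨0, hN⟩ j 1 := by
      induction m generalizing j with
      | zero =>
        obtain ⟨x, hx⟩ := hφ.exists_eq_single (i := ⟨0, hN⟩) (j := j)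
          ((hf.lt_apply 0 hN).trans_le hj)
        exact ⟨⟨x, (mem_staircaseIdeal_of_eq_single hx).2 hj⟩, by simp, hx⟩
      | succ m ih =>
        rw [Function.iterate_succ_apply'] at hj
        have hp : f^[m + 1] 0 < N := by
          by_contra! hp
          rw [hf.apply_eq _ hp] at hj
          omega
        have hpj : f^[m + 1] 0 < j := (hf.lt_apply _ hp).trans_le hj
        obtain ⟨z, hz, hzφ⟩ := ih ⟨_, hp⟩ le_rfl
        obtain ⟨x, hx⟩ := hφ.exists_eq_single (i := ⟨_, hp⟩) (j := j) hpj
        have hxI : x ∈ I := (mem_staircaseIdeal_of_eq_single hx).2 hj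
        -- With p = f^[m + 1](0), this is E_{0p} E_{pj} = E_{0j}; the opposite product vanishes
        -- since j ≠ 0.
        refine ⟨-⁅(⟨x, hxI⟩ : I), z⁆, ?_, ?_⟩
        · rw [LieModule.lowerCentralSeries_succ]
          exact neg_mem (LieSubmodule.lie_mem_lie (LieSubmodule.mem_top _) hz)
        · have h0 : (⟨0, hN⟩ : Fin N) ≠ j := by
            rintro rfl
            exact absurd hpj (Nat.not_lt_zero _)
          change φ (-⁅x, (z : B)⁆) = _
          rw [lie_skew, LieHom.map_lie, hx, hzφ, Ring.lie_def, Matrix.single_mul_single_same,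
            Matrix.single_mul_single_of_ne _ _ _ _ h0.symm, sub_zero, one_mul]
    obtain ⟨z, hz, hzφ⟩ := key m ⟨_, lt_of_le_of_ne (hle m 0) hne⟩ le_rfl
    rw [h, LieSubmodule.mem_bot] at hz
    rw [hz] at hzφ
    have := congr_fun (congr_fun hzφ ⟨0, hN⟩) ⟨_, lt_of_le_of_ne (hle m 0) hne⟩
    simp at this
  · intro h
    have key (m : ℕ) : LieModule.lowerCentralSeries ℂ I I m ≤
        LieIdeal.comap I.incl (staircaseIdeal φ hφ.upper _ (hmono (m + 1))) := by
      induction m with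
      | zero =>
        intro y _
        rw [LieIdeal.mem_comap]
        exact y.2
      | succ m ih =>
        rw [LieModule.lowerCentralSeries_succ, LieSubmodule.lie_le_iff]
        intro x _ y hy
        replace hy := ih hy
        rw [LieIdeal.mem_comap, mem_staircaseIdeal] at hy
        have hx : ∀ i j : Fin N, (j : ℕ) < f i → φ x i j = 0 := x.2
        rw [LieIdeal.mem_comap, mem_staircaseIdeal]
        intro i j hij
        change φ ⁅(x : B), (y : B)⁆ i j = 0
        change ∀ i j : Fin N, (j : ℕ) < f^[m + 1] i → φ (y : B) i j = 0 at hy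
        rw [apply_lie_apply]
        refine Finset.sum_eq_zero fun k _ => ?_
        have h₁ : φ x i k * φ y k j = 0 := by
          rcases lt_or_ge (k : ℕ) (f i) with hk | hk
          · rw [hx i k hk, zero_mul]
          · rw [Function.iterate_succ_apply] at hij
            rw [hy k j (hij.trans_le (hmono _ hk)), mul_zero]
        have h₂ : φ y i k * φ x k j = 0 := by
          rcases lt_or_ge (k : ℕ) (f^[m + 1] i) with hk | hk
          · rw [hy i k hk, zero_mul]
          · rw [Function.iterate_succ_apply'] at hij
            rw [hx k j (hij.trans_le (hf.mono hk)), mul_zero]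
        rw [h₁, h₂, sub_zero]
    rw [eq_bot_iff]
    intro y hy
    replace hy := key m hy
    rw [LieIdeal.mem_comap, mem_staircaseIdeal] at hy
    rw [LieSubmodule.mem_bot]
    apply Subtype.ext
    apply hφ.injective
    ext i j
    change φ (y : B) i j = φ 0 i j
    rw [map_zero]
    exact hy i j ((j.2.trans_eq h.symm).trans_le (hmono _ (Nat.zero_le _)))

end IsUpperTriangularModel

end UpperTriangularModel

/-! ### The continued fraction and Chebyshev polynomials. -/

/-- The continued fraction `contFrac X k` as a formal power series. -/
noncomputable def contFracSeries : ℕ → PowerSeries ℚ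
  | 0 => 1
  | k + 1 => (1 - PowerSeries.X * contFracSeries k)⁻¹

theorem contFracSeries_succ_mul (k : ℕ) :
    contFracSeries (k + 1) * (1 - PowerSeries.X * contFracSeries k) = 1 := by
  rw [contFracSeries, PowerSeries.inv_mul_cancel]
  simp

theorem contFracSeries_succ (k : ℕ) : contFracSeries (k + 1) =
    1 + PowerSeries.X * contFracSeries (k + 1) * contFracSeries k := by
  linear_combination contFracSeries_succ_mul k

theorem constantCoeff_contFracSeries (k : ℕ) :
    PowerSeries.constantCoeff (contFracSeries k) = 1 := by
  cases k with
  | zero => simp [contFracSeries]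
  | succ k => rw [contFracSeries_succ]; simp

theorem inSqrtX_mul (F G : PowerSeries ℚ) : inSqrtX (F * G) = inSqrtX F * inSqrtX G := by
  simp [inSqrtX]

theorem inSqrtX_contFracSeries (k : ℕ) :
    inSqrtX (contFracSeries k) = contFrac (sqrtX ^ 2) k := by
  induction k with
  | zero => simp [inSqrtX, contFracSeries, contFrac]
  | succ k ih =>
    have h := congrArg inSqrtX (contFracSeries_succ_mul k)
    rw [inSqrtX_mul] at h
    have h1 : inSqrtX 1 = 1 := by simp [inSqrtX]
    have h2 : inSqrtX (1 - PowerSeries.X * contFracSeries k) =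
        1 - sqrtX ^ 2 * inSqrtX (contFracSeries k) := by
      simp [inSqrtX, sqrtX]
    rw [h1, h2, ih] at h
    rw [contFrac]
    exact eq_one_div_of_mul_eq_one_left h

theorem contFrac_sqrtX_ne_zero (k : ℕ) : contFrac (sqrtX ^ 2) (k + 1) ≠ 0 := by
  intro h
  have h' := congrArg inSqrtX (contFracSeries_succ_mul k)
  rw [inSqrtX_mul, inSqrtX_contFracSeries, h] at h'
  simp [inSqrtX] at h'

theorem sqrtX_ne_zero : sqrtX ≠ 0 := by
  intro h
  rw [sqrtX, ← PowerSeries.coe_zero] at h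
  exact PowerSeries.X_ne_zero (HahnSeries.ofPowerSeries_injective h)

theorem two_ne_zero_laurentSeries : (2 : LaurentSeries ℚ) ≠ 0 := by
  have := charZero_of_injective_algebraMap (algebraMap ℚ (LaurentSeries ℚ)).injective
  exact two_ne_zero

theorem chebyshevU_sqrtX_add_two (k : ℕ) :
    sqrtX * chebyshevU (k + 2) (1 / (2 * sqrtX)) =
      chebyshevU (k + 1) (1 / (2 * sqrtX)) - sqrtX * chebyshevU k (1 / (2 * sqrtX)) := by
  have h := sqrtX_ne_zero
  have h2 : (2 : LaurentSeries ℚ) ≠ 0 := two_ne_zero_laurentSeries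
  simp only [chebyshevU]
  push_cast
  rw [Polynomial.Chebyshev.U_add_two]
  simp only [Polynomial.eval_sub, Polynomial.eval_mul, Polynomial.eval_ofNat, Polynomial.eval_X]
  field_simp

theorem contFrac_sqrtX_eq (k : ℕ) : chebyshevU k (1 / (2 * sqrtX)) ≠ 0 ∧
    contFrac (sqrtX ^ 2) k =
      chebyshevU k (1 / (2 * sqrtX)) / (sqrtX * chebyshevU (k + 1) (1 / (2 * sqrtX))) := by
  have hs := sqrtX_ne_zero
  have h2 : (2 : LaurentSeries ℚ) ≠ 0 := two_ne_zero_laurentSeries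
  induction k with
  | zero =>
    simp only [chebyshevU, contFrac]
    simp
    field_simp
  | succ k ih =>
    obtain ⟨hU, hc⟩ := ih
    have hU' : chebyshevU (k + 1) (1 / (2 * sqrtX)) ≠ 0 := by
      intro h0
      -- Division by zero yields zero, so a vanishing U_{k+1} would force c_k = 0, whereas every c_k
      -- is nonzero.
      rw [h0, mul_zero, div_zero] at hc
      cases k with
      | zero => simp [contFrac] at hc
      | succ k => exact contFrac_sqrtX_ne_zero k hc
    refine ⟨hU', ?_⟩
    rw [contFrac, hc, chebyshevU_sqrtX_add_two]
    have : 1 - sqrtX ^ 2 * (chebyshevU k (1 / (2 * sqrtX)) /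
        (sqrtX * chebyshevU (k + 1) (1 / (2 * sqrtX)))) =
        (chebyshevU (k + 1) (1 / (2 * sqrtX)) - sqrtX * chebyshevU k (1 / (2 * sqrtX))) /
          chebyshevU (k + 1) (1 / (2 * sqrtX)) := by
      generalize chebyshevU (k + 1) (1 / (2 * sqrtX)) = u at hU'
      generalize chebyshevU k (1 / (2 * sqrtX)) = v
      field_simp
    rw [this, one_div_div]

/-! ### Counting staircases by the length of the orbit of 0. -/

/-- The staircase functions that agree with `g` before `p`, take values at least `v` from `p` on,
and whose iterates reach `N` from `s` in `k` steps. -/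
def restrictedStaircases (N : ℕ) (g : ℕ → ℕ) (p v k s : ℕ) : Set (ℕ → ℕ) :=
  {f | IsStaircase N f ∧ (∀ i < p, f i = g i) ∧ v ≤ f p ∧ f^[k] s = N}

/-- `g` restricts to a strictly inflationary monotone function on `i < p` with values at most
`v`. -/
structure IsPartialStaircase (g : ℕ → ℕ) (p v : ℕ) : Prop where
  mono : ∀ i j, i ≤ j → j < p → g i ≤ g j
  lt_apply : ∀ i < p, i < g i
  apply_le : ∀ i < p, g i ≤ v

theorem IsPartialStaircase.update {g : ℕ → ℕ} {p v : ℕ} (hg : IsPartialStaircase g p v)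
    (hpv : p < v) : IsPartialStaircase (Function.update g p v) (p + 1) v where
  mono i j hij hj := by
    rcases Nat.lt_succ_iff_lt_or_eq.1 hj with h | rfl
    · rw [Function.update_of_ne h.ne, Function.update_of_ne (hij.trans_lt h).ne]
      exact hg.mono i j hij h
    · rw [Function.update_self]
      rcases hij.eq_or_lt with rfl | h
      · rw [Function.update_self]
      · rw [Function.update_of_ne h.ne]
        exact hg.apply_le i h
  lt_apply i hi := by
    rcases Nat.lt_succ_iff_lt_or_eq.1 hi with h | rfl
    · rw [Function.update_of_ne h.ne]
      exact hg.lt_apply i h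
    · rwa [Function.update_self]
  apply_le i hi := by
    rcases Nat.lt_succ_iff_lt_or_eq.1 hi with h | rfl
    · rw [Function.update_of_ne h.ne]
      exact hg.apply_le i h
    · rw [Function.update_self]

theorem restrictedStaircases_self {N p k s : ℕ} {g : ℕ → ℕ} (hg : IsPartialStaircase g p N)
    (hps : p ≤ s) (hsN : s ≤ N) :
    restrictedStaircases N g p N (k + 1) s = {fun i => if i < p then g i else N} := by
  ext f
  rw [Set.mem_singleton_iff]
  constructor
  · rintro ⟨hf, hfg, hfp, -⟩
    ext i
    split_ifs with hi
    · exact hfg i hi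
    · exact le_antisymm (hf.apply_le i) (hfp.trans (hf.mono (not_lt.1 hi)))
  · rintro rfl
    refine ⟨⟨fun i j hij => ?_, fun i hi => ?_, fun i => ?_, fun i hi => ?_⟩, fun i hi => ?_, ?_, ?_⟩
    · split_ifs with hi hj hj
      · exact hg.mono i j hij hj
      · exact hg.apply_le i hi
      · omega
      · exact le_rfl
    · split_ifs with h
      · exact hg.lt_apply i h
      · exact hi
    · split_ifs with h
      · exact hg.apply_le i h
      · exact le_rfl
    · rw [if_neg (by omega)]
    · exact if_pos hi
    · simp
    · rw [Function.iterate_succ_apply, if_neg (not_lt.2 hps)]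
      exact Function.iterate_fixed (f := fun i => if i < p then g i else N)
        (if_neg (not_lt.2 (hps.trans hsN))) k

theorem restrictedStaircases_eq_union (N : ℕ) (g : ℕ → ℕ) (p v k s : ℕ) :
    restrictedStaircases N g p v k s =
      {f ∈ restrictedStaircases N g p v k s | f p = v} ∪
        restrictedStaircases N g p (v + 1) k s := by
  ext f
  simp only [restrictedStaircases, Set.mem_union, Set.mem_ofPred_eq]
  constructor
  · rintro ⟨hf, hfg, hfp, hk⟩
    rcases hfp.eq_or_lt with h | h
    · exact Or.inl ⟨⟨hf, hfg, hfp, hk⟩, h.symm⟩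
    · exact Or.inr ⟨hf, hfg, h, hk⟩
  · rintro (⟨h, -⟩ | ⟨hf, hfg, hfp, hk⟩)
    · exact h
    · exact ⟨hf, hfg, by omega, hk⟩

theorem sep_restrictedStaircases (N : ℕ) (g : ℕ → ℕ) (p v k s : ℕ) :
    {f ∈ restrictedStaircases N g p v k s | f p = v} =
      restrictedStaircases N (Function.update g p v) (p + 1) v k s := by
  ext f
  simp only [restrictedStaircases, Set.mem_ofPred_eq]
  constructor
  · rintro ⟨⟨hf, hfg, hfp, hk⟩, h⟩
    refine ⟨hf, fun i hi => ?_, hfp.trans (hf.mono p.le_succ), hk⟩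
    rcases Nat.lt_succ_iff_lt_or_eq.1 hi with h | rfl
    · rw [Function.update_of_ne h.ne]
      exact hfg i h
    · rwa [Function.update_self]
  · rintro ⟨hf, hfg, hfp, hk⟩
    have h : f p = v := by rw [hfg p p.lt_succ_self, Function.update_self]
    refine ⟨⟨hf, fun i hi => ?_, h.ge, hk⟩, h⟩
    rw [hfg i (hi.trans p.lt_succ_self), Function.update_of_ne hi.ne]

/-- Once f(p) = v is fixed, the orbit advances from p to v and uses up one iteration. -/
theorem restrictedStaircases_update_succ (N : ℕ) (g : ℕ → ℕ) (p v k : ℕ) :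
    restrictedStaircases N (Function.update g p v) (p + 1) v (k + 1) p =
      restrictedStaircases N (Function.update g p v) (p + 1) v k v := by
  ext f
  simp only [restrictedStaircases, Set.mem_ofPred_eq]
  refine and_congr_right fun hf => and_congr_right fun hfg => ?_
  rw [Function.iterate_succ_apply, hfg p p.lt_succ_self, Function.update_self]

-- This is the recursion of the count: the first summand matches f(p) = v, which moves on to p + 1;
-- the second matches f(p) > v, which spends one of the N - v remaining values.
open PowerSeries in
theorem coeff_succ_contFracSeries (M k a b : ℕ) :
    coeff (M + 1) (contFracSeries (k + 1) ^ (a + 1) * contFracSeries k ^ b) =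
      coeff (M + 1) (contFracSeries (k + 1) ^ a * contFracSeries k ^ b) +
        coeff M (contFracSeries (k + 1) ^ (a + 1) * contFracSeries k ^ (b + 1)) := by
  rw [← coeff_succ_X_mul M, ← map_add]
  congr 1
  linear_combination
    contFracSeries (k + 1) ^ a * contFracSeries k ^ b * contFracSeries_succ k

open PowerSeries in
/-- The generating function of `restrictedStaircases` in the number `N - v` of available
values. -/
theorem encard_restrictedStaircases {N k p s v : ℕ} {g : ℕ → ℕ}
    (hps : p ≤ s) (hsv : s ≤ v) (hvN : v ≤ N) (hg : IsPartialStaircase g p v) :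
    ∃ d : ℕ, (restrictedStaircases N g p v (k + 1) s).encard = d ∧
      (d : ℚ) =
        coeff (N - v) (contFracSeries (k + 1) ^ (s + 1 - p) * contFracSeries k ^ (v - s)) := by
  -- Either p or v increases at each step.
  induction hn : (N - p) + (N - v) using Nat.strong_induction_on generalizing k p s v g with
  | _ n ih =>
  subst hn
  rcases hvN.eq_or_lt with rfl | hvN
  · refine ⟨1, by simp [restrictedStaircases_self hg hps hsv], ?_⟩
    simp [constantCoeff_contFracSeries]
  have hfirst : ∃ d : ℕ,
      (restrictedStaircases N (Function.update g p v) (p + 1) v (k + 1) s).encard = d ∧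
      (d : ℚ) =
        coeff (N - v) (contFracSeries (k + 1) ^ (s - p) * contFracSeries k ^ (v - s)) := by
    have hone : coeff (N - v) (1 : ℚ⟦X⟧) = 0 := by
      rw [coeff_one, if_neg (by omega)]
    rcases hps.lt_or_eq with hps | rfl
    · obtain ⟨d, hd, hd'⟩ := ih _ (by omega) (k := k) (s := s) (by omega) hsv hvN.le
        (hg.update (hps.trans_le hsv)) rfl
      exact ⟨d, hd, by rw [hd', Nat.add_sub_add_right]⟩
    -- At p = s all factors c_{k+1} but one are used up, and fixing f(p) removes the last. The
    -- remaining c_k^(v - s) is the formula at the new orbit point v, one level lower.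
    · rw [restrictedStaircases_update_succ, Nat.sub_self, pow_zero, one_mul]
      rcases hsv.eq_or_lt with rfl | hsv
      · refine ⟨0, ?_, ?_⟩
        · rw [Nat.cast_zero, Set.encard_eq_zero, Set.eq_empty_iff_forall_notMem]
          rintro f ⟨hf, hfg, -⟩
          have h := hf.lt_apply p hvN
          rw [hfg p p.lt_succ_self, Function.update_self] at h
          exact lt_irrefl _ h
        · rw [Nat.sub_self p, pow_zero, hone, Nat.cast_zero]
      -- With no iteration left the orbit stops at v < N, so nothing is counted; accordingly c_0 = 1
      -- has no positive-degree coefficient.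
      · cases k with
        | zero =>
          refine ⟨0, ?_, ?_⟩
          · rw [Nat.cast_zero, Set.encard_eq_zero, Set.eq_empty_iff_forall_notMem]
            rintro f ⟨-, -, -, h⟩
            exact hvN.ne h
          · rw [contFracSeries, one_pow, hone, Nat.cast_zero]
        | succ k =>
          obtain ⟨d, hd, hd'⟩ := ih _ (by omega) (k := k) (s := v) (by omega) le_rfl hvN.le
            (hg.update hsv) rfl
          refine ⟨d, hd, ?_⟩
          rw [hd', Nat.sub_self, pow_zero, mul_one, Nat.add_sub_add_right]
  obtain ⟨d₁, hd₁, hd₁'⟩ := hfirst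
  obtain ⟨d₂, hd₂, hd₂'⟩ := ih _ (by omega) (k := k) (v := v + 1) hps (by omega) hvN
    ⟨hg.mono, hg.lt_apply, fun i hi => (hg.apply_le i hi).trans v.le_succ⟩ rfl
  refine ⟨d₁ + d₂, ?_, ?_⟩
  · rw [restrictedStaircases_eq_union, Set.encard_union_eq, sep_restrictedStaircases, hd₁, hd₂,
      Nat.cast_add]
    rw [Set.disjoint_left]
    rintro f ⟨-, h⟩ ⟨-, -, h', -⟩
    omega
  · rw [Nat.cast_add, hd₁', hd₂']
    obtain ⟨M, hM⟩ : ∃ M, N - v = M + 1 := ⟨N - v - 1, by omega⟩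
    rw [hM, show N - (v + 1) = M by omega, show s + 1 - p = s - p + 1 by omega,
      show v + 1 - s = v - s + 1 by omega, coeff_succ_contFracSeries]

/-- The case p = s = v = 0, where the product reduces to c_{k+1}. Equating an `encard` with a
natural number yields finiteness along with the count. -/
theorem encard_isStaircase (N k : ℕ) : ∃ d : ℕ,
    {f | IsStaircase N f ∧ f^[k + 1] 0 = N}.encard = d ∧
      (d : ℚ) = PowerSeries.coeff N (contFracSeries (k + 1)) := by
  obtain ⟨d, hd, hd'⟩ := encard_restrictedStaircases (k := k) (g := id) le_rfl le_rfl
    (Nat.zero_le N) ⟨by simp, by simp, by simp⟩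
  refine ⟨d, ?_, by simpa using hd'⟩
  rw [← hd]
  simp [restrictedStaircases]

/-! ### Borel subalgebras and ad-nilpotency in matrix terms. -/

/-- Cayley–Hamilton: the characteristic polynomial is a power of X. -/
theorem isNilpotent_of_strictlyUpperTriangular {N : ℕ} {A : Matrix (Fin N) (Fin N) ℂ}
    (hA : ∀ i j, j ≤ i → A i j = 0) : IsNilpotent A := by
  have h : A.BlockTriangular id := fun i j hij => hA i j (le_of_lt hij)
  have h' := A.aeval_self_charpoly
  rw [Matrix.charpoly_of_isUpperTriangular A h] at h'
  simp [hA _ _ le_rfl] at h'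
  exact ⟨_, h'⟩

/-- The conjugation by `P` on `sl N`. -/
noncomputable def slConj {N : ℕ} (P : Matrix (Fin N) (Fin N) ℂ) (hP : Invertible P) :
    sl (Fin N) ℂ →ₗ⁅ℂ⁆ Matrix (Fin N) (Fin N) ℂ :=
  (P.lieConj hP).toLieHom.comp (sl (Fin N) ℂ).incl

theorem slConj_apply {N : ℕ} (P : Matrix (Fin N) (Fin N) ℂ) (hP : Invertible P)
    (x : sl (Fin N) ℂ) : slConj P hP x = P * x * P⁻¹ :=
  Matrix.lieConj_apply P x hP

theorem slConj_injective {N : ℕ} (P : Matrix (Fin N) (Fin N) ℂ) (hP : Invertible P) :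
    Function.Injective (slConj P hP) :=
  (P.lieConj hP).injective.comp Subtype.val_injective

theorem trace_slConj {N : ℕ} (P : Matrix (Fin N) (Fin N) ℂ) (hP : Invertible P)
    (x : sl (Fin N) ℂ) : (slConj P hP x).trace = 0 := by
  rw [slConj_apply, Matrix.trace_mul_cycle, Matrix.inv_mul_of_invertible, Matrix.one_mul]
  exact x.2

theorem exists_slConj_eq {N : ℕ} (P : Matrix (Fin N) (Fin N) ℂ) (hP : Invertible P)
    {A : Matrix (Fin N) (Fin N) ℂ} (hA : A.trace = 0) : ∃ x, slConj P hP x = A := by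
  refine ⟨⟨(P.lieConj hP).symm A, ?_⟩, (P.lieConj hP).apply_symm_apply A⟩
  change Matrix.trace ((P.lieConj hP).symm A) = 0
  rw [Matrix.lieConj_symm_apply, Matrix.trace_mul_cycle, Matrix.mul_inv_of_invertible,
    Matrix.one_mul, hA]

/-- A Borel subalgebra of `sl N` is conjugate to the Lie algebra of traceless upper triangular
matrices. -/
theorem IsBorelSubalgebra.exists_model {N : ℕ} {b : LieSubalgebra ℂ (sl (Fin N) ℂ)}
    (hb : IsBorelSubalgebra b) : ∃ (P : Matrix (Fin N) (Fin N) ℂ) (hP : Invertible P),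
      IsUpperTriangularModel ((slConj P hP).comp b.incl) := by
  have : LieAlgebra.IsSolvable b := hb.1
  obtain ⟨v, hv⟩ := exists_basis_upperTriangular (L := b) (V := Fin N → ℂ) (n := N) (by simp)
  let Q := (Pi.basisFun ℂ (Fin N)).toMatrix v
  let P := v.toMatrix (Pi.basisFun ℂ (Fin N))
  have hPQ : P * Q = 1 := Module.Basis.toMatrix_mul_toMatrix_flip _ _
  have hQP : Q * P = 1 := Module.Basis.toMatrix_mul_toMatrix_flip _ _
  let hP : Invertible P := ⟨Q, hQP, hPQ⟩
  have hPinv : P⁻¹ = Q := Matrix.inv_eq_right_inv hPQ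
  have hentry (A : Matrix (Fin N) (Fin N) ℂ) (i j : Fin N) :
      (P * A * P⁻¹) i j = v.repr (A.mulVec (v j)) i := by
    have h := basis_toMatrix_mul_linearMap_toMatrix_mul_basis_toMatrix
      v (Pi.basisFun ℂ (Fin N)) v (Pi.basisFun ℂ (Fin N)) (Matrix.toLin' A)
    rw [hPinv, ← Matrix.toLin'_apply, ← LinearMap.toMatrix_apply, ← h,
      LinearMap.toMatrix_eq_toMatrix', LinearMap.toMatrix'_toLin']
  let φ := slConj P hP
  have hφ : Function.Injective φ := slConj_injective P hP
  let t : LieSubalgebra ℂ (sl (Fin N) ℂ) :=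
    { carrier := {x | ∀ i j : Fin N, j < i → φ x i j = 0}
      add_mem' := by
        intro x y hx hy i j hij
        simp [hx i j hij, hy i j hij]
      zero_mem' := by simp
      smul_mem' := by
        intro c x hx i j hij
        simp [hx i j hij]
      lie_mem' := by
        intro x y hx hy i j hij
        rw [apply_lie_apply]
        refine Finset.sum_eq_zero fun k _ => ?_
        rcases lt_or_ge k i with hk | hk
        · rw [hx i k hk, hy i k hk]; ring
        · rw [hx k j (hij.trans_le hk), hy k j (hij.trans_le hk)]; ring }
  have ht : LieAlgebra.IsSolvable t :=
    isSolvable_of_upperTriangular (φ.comp t.incl) (hφ.comp Subtype.val_injective) fun x => x.2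
  have hbt : b ≤ t := by
    intro x hx i j hij
    have h := hv ⟨x, hx⟩ i j hij
    rw [slConj_apply, hentry]
    exact h
  -- Maximality: the full preimage t of the triangular matrices is solvable and contains b.
  have htb : t ≤ b := hb.2 ht hbt
  refine ⟨P, hP, hφ.comp Subtype.val_injective, fun x => hbt x.2, fun A hA htr => ?_⟩
  obtain ⟨x, rfl⟩ := exists_slConj_eq P hP htr
  exact ⟨⟨x, htb hA⟩, rfl⟩

/-- An `ad`-nilpotent upper triangular matrix has a constant diagonal. -/
theorem slConj_apply_self_eq_of_isNilpotent_ad {N : ℕ} {P : Matrix (Fin N) (Fin N) ℂ}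
    {hP : Invertible P} {y : sl (Fin N) ℂ} (hy : ∀ i j, j < i → slConj P hP y i j = 0)
    (hnil : IsNilpotent (LieAlgebra.ad ℂ (sl (Fin N) ℂ) y)) {i j : Fin N} (hij : i ≠ j) :
    slConj P hP y i i = slConj P hP y j j := by
  obtain ⟨z, hz⟩ := exists_slConj_eq P hP (Matrix.trace_single_eq_of_ne i j (1 : ℂ) hij)
  -- Matrices supported on rows up to i and columns from j on are stable under ad y, which
  -- multiplies the corner entry (i, j) by y_ii - y_jj.
  have key (n : ℕ) :
      (∀ a c, ¬(a ≤ i ∧ j ≤ c) → slConj P hP ((LieAlgebra.ad ℂ (sl (Fin N) ℂ) y ^ n) z) a c = 0) ∧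
      slConj P hP ((LieAlgebra.ad ℂ (sl (Fin N) ℂ) y ^ n) z) i j =
        (slConj P hP y i i - slConj P hP y j j) ^ n := by
    induction n with
    | zero =>
      refine ⟨fun a c hac => ?_, by simp [hz]⟩
      rw [pow_zero, Module.End.one_apply, hz]
      apply Matrix.single_apply_of_ne
      rintro ⟨rfl, rfl⟩
      exact hac ⟨le_rfl, le_rfl⟩
    | succ n ih =>
      rw [pow_succ', Module.End.mul_apply, LieAlgebra.ad_apply]
      generalize (LieAlgebra.ad ℂ (sl (Fin N) ℂ) y ^ n) z = w at ih
      obtain ⟨h₀, h₁⟩ := ih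
      constructor
      · intro a c hac
        rw [apply_lie_apply]
        refine Finset.sum_eq_zero fun k _ => ?_
        have e₁ : slConj P hP y a k * slConj P hP w k c = 0 := by
          rcases lt_or_ge k a with hk | hk
          · rw [hy a k hk, zero_mul]
          · rw [h₀ k c (fun h => hac ⟨hk.trans h.1, h.2⟩), mul_zero]
        have e₂ : slConj P hP w a k * slConj P hP y k c = 0 := by
          rcases lt_or_ge c k with hk | hk
          · rw [hy k c hk, mul_zero]
          · rw [h₀ a k (fun h => hac ⟨h.1, h.2.trans hk⟩), zero_mul]
        rw [e₁, e₂, sub_zero]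
      · rw [apply_lie_apply, Finset.sum_sub_distrib, Finset.sum_eq_single i, Finset.sum_eq_single j,
          h₁]
        · ring
        · intro k _ hk
          rcases lt_or_ge j k with h | h
          · rw [hy k j h, mul_zero]
          · rw [h₀ i k (fun h' => hk (le_antisymm h h'.2)), zero_mul]
        · simp
        · intro k _ hk
          rcases lt_or_ge k i with h | h
          · rw [hy i k h, zero_mul]
          · rw [h₀ k j (fun h' => hk (le_antisymm h'.1 h)), mul_zero]
        · simp
  obtain ⟨n, hn⟩ := hnil
  have h := (key n).2
  rw [hn, LinearMap.zero_apply, map_zero, Matrix.zero_apply] at h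
  exact sub_eq_zero.1 (eq_zero_of_pow_eq_zero h.symm)

/-- Ad-nilpotency makes the diagonal constant, and trace zero makes it vanish. Conversely, a
nilpotent matrix is ad-nilpotent. -/
theorem isAdNilpotentIdeal_iff {N : ℕ} {b : LieSubalgebra ℂ (sl (Fin N) ℂ)}
    {P : Matrix (Fin N) (Fin N) ℂ} {hP : Invertible P}
    (hb : IsUpperTriangularModel ((slConj P hP).comp b.incl)) (I : LieIdeal ℂ b) :
    IsAdNilpotentIdeal b I ↔ ∀ y ∈ I, ∀ i j, j ≤ i → (slConj P hP).comp b.incl y i j = 0 := by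
  constructor
  · intro hI y hy i j hij
    rcases hij.lt_or_eq with hij | rfl
    · exact hb.upper y i j hij
    · have htr := trace_slConj P hP (y : sl (Fin N) ℂ)
      have hd (k : Fin N) : slConj P hP y k k = slConj P hP y j j := by
        rcases eq_or_ne k j with rfl | hk
        · rfl
        · exact slConj_apply_self_eq_of_isNilpotent_ad (hb.upper y) (hI y hy) hk
      have hsum : (slConj P hP y).trace = ∑ _k : Fin N, slConj P hP y j j :=
        Finset.sum_congr rfl fun k _ => hd k
      rw [hsum, Finset.sum_const, Finset.card_univ, Fintype.card_fin, nsmul_eq_mul] at htr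
      have hN : (N : ℂ) ≠ 0 := by have := j.pos; exact_mod_cast this.ne'
      exact (mul_eq_zero.1 htr).resolve_left hN
  · intro hI y hy
    obtain ⟨k, hk⟩ := isNilpotent_of_strictlyUpperTriangular (hI y hy)
    apply LieAlgebra.isNilpotent_ad_of_isNilpotent
    refine ⟨k, (P.lieConj hP).injective ?_⟩
    change (slConj P hP y) ^ k = 0 at hk
    rw [slConj_apply] at hk
    change P.lieConj hP ((y : Matrix (Fin N) (Fin N) ℂ) ^ k) = P.lieConj hP 0
    rw [Matrix.lieConj_apply, map_zero, ← hk, ← Matrix.invOf_eq_nonsing_inv]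
    exact (Units.conj_pow (unitOfInvertible P) _ k).symm

/-- Nilpotency must be required separately, since the infimum of the empty set is 0; beyond that,
the lower central series is decreasing. -/
theorem isNilpotent_and_idealNilpotencyClass_le_iff {L : Type*} [LieRing L] [LieAlgebra ℂ L]
    {b : LieSubalgebra ℂ L} (I : LieIdeal ℂ b) (h : ℕ) :
    LieRing.IsNilpotent I ∧ idealNilpotencyClass I ≤ h ↔
      LieModule.lowerCentralSeries ℂ I I h = ⊥ := by
  constructor
  · rintro ⟨hn, hle⟩
    have hne : {m : ℕ | LieModule.lowerCentralSeries ℂ I I m = ⊥}.Nonempty :=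
      (LieModule.isNilpotent_iff ℂ I I).1 hn
    have hmem : LieModule.lowerCentralSeries ℂ I I (idealNilpotencyClass I) = ⊥ :=
      Nat.sInf_mem hne
    rw [eq_bot_iff, ← hmem]
    exact LieModule.antitone_lowerCentralSeries ℂ I I hle
  · intro hh
    exact ⟨(LieModule.isNilpotent_iff ℂ I I).2 ⟨h, hh⟩, Nat.sInf_le hh⟩

theorem encard_adNilpotentIdealsOfClassLE {N : ℕ} (hN : 0 < N)
    {b : LieSubalgebra ℂ (sl (Fin N) ℂ)} (hb : IsBorelSubalgebra b) (h : ℕ) :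
    ∃ d : ℕ, (adNilpotentIdealsOfClassLE b h).encard = d ∧
      (d : ℚ) = PowerSeries.coeff N (contFracSeries (h + 1)) := by
  obtain ⟨P, hP, hφ⟩ := hb.exists_model
  obtain ⟨d, hd, hd'⟩ := encard_isStaircase N h
  refine ⟨d, ?_, hd'⟩
  rw [← hd]
  symm
  refine Set.encard_congr (Equiv.ofBijective (fun f => ⟨staircaseIdeal _ hφ.upper f.1 f.2.1.mono,
    ?_, (isNilpotent_and_idealNilpotencyClass_le_iff _ h).2 ((hφ.lowerCentralSeries_eq_bot_iff f.2.1 hN h).2 f.2.2)⟩) ⟨?_, ?_⟩)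
  · rw [isAdNilpotentIdeal_iff hφ]
    intro y hy i j hij
    exact hy i j (lt_of_le_of_lt hij (f.2.1.lt_apply i i.2))
  · intro f g hfg
    exact Subtype.ext (hφ.staircaseIdeal_injective f.2.1 g.2.1 (congrArg Subtype.val hfg))
  · rintro ⟨I, hI, hcl⟩
    obtain ⟨f, hf, rfl⟩ := hφ.exists_eq_staircaseIdeal I ((isAdNilpotentIdeal_iff hφ I).1 hI)
    exact ⟨⟨f, hf, (hφ.lowerCentralSeries_eq_bot_iff hf hN h).1 ((isNilpotent_and_idealNilpotencyClass_le_iff _ h).1 hcl)⟩, rfl⟩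

theorem theorem4p6
    (b : ∀ n : ℕ, LieSubalgebra ℂ (sl (Fin (n + 1)) ℂ)) (hb : ∀ n, IsBorelSubalgebra (b n))
    (h : ℕ) :
    (∀ n, (adNilpotentIdealsOfClassLE (b n) h).Finite) ∧
    inSqrtX (idealGenFun b h) =
      chebyshevU (h + 1) (1 / (2 * sqrtX)) / (sqrtX * chebyshevU (h + 2) (1 / (2 * sqrtX))) ∧
    inSqrtX (idealGenFun b h) = contFrac (sqrtX ^ 2) (h + 1) := by
  have hcard (n : ℕ) := encard_adNilpotentIdealsOfClassLE n.succ_pos (hb n) h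
  have hgen : idealGenFun b h = contFracSeries (h + 1) := by
    ext n
    rw [idealGenFun, map_add]
    cases n with
    | zero =>
      rw [PowerSeries.coeff_zero_X_mul, PowerSeries.coeff_zero_one, add_zero,
        PowerSeries.coeff_zero_eq_constantCoeff_apply, constantCoeff_contFracSeries]
    | succ n =>
      obtain ⟨d, hd, hd'⟩ := hcard n
      rw [PowerSeries.coeff_succ_X_mul, PowerSeries.coeff_mk, PowerSeries.coeff_one,
        if_neg n.succ_ne_zero, zero_add, ← hd', Set.ncard, hd, ENat.toNat_natCast]
  refine ⟨fun n => ?_, ?_, ?_⟩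
  · obtain ⟨d, hd, -⟩ := hcard n
    exact Set.finite_of_encard_eq_coe hd
  · rw [hgen, inSqrtX_contFracSeries]
    exact (contFrac_sqrtX_eq (h + 1)).2
  · rw [hgen, inSqrtX_contFracSeries]
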